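/- Let $M$ be a Lie monoid, i.e. a (finite-dimensional, Hausdorff) smooth manifold with or without boundary, together with a monoid structure with unit $e$ whose multiplication $M\times M\to M$ is smooth. Assume that $M$ has normal boundary: either $e\in\operatorname{Int}M$, or $e\in\partial M$ and $\partial M$ is a submonoid of $M$. Let $X$ be a smooth vector field on $M$ that is left-invariant, i.e. $\mathrm d(L_g)_h(X_h)=X_{gh}$ for all $g,h\in M$, where $L_g(h)=gh$. For $g\in M$ there is a unique maximal integral path of $X$ starting at $g$ at time $0$; let $J_g\ni 0$ be the interval (not necessarily open) on which it is defined, and for $t\in J_g$ let $\phi_t(g)$ denote its value at time $t$. Call $X$ complete if $J_g=\mathbb R$ for all $g\in M$, and half-complete if for every $g\in M$ either $[0,\infty)\subset J_g$ or $(-\infty,0]\subset J_g$. A vector $v\in T_pM$, $p\in\partial M$, is called inward-pointing (resp. outward-pointing) if it is not tangent to $\partial M$ and it is the velocity at time $0$ of a smooth curve $[0,\varepsilon)\to M$ (resp. $(-\varepsilon,0]\to M$), for some $\varepsilon>0$, passing through $p$ at time $0$. Then: (i) If $e\in\operatorname{Int}M$, or if $e\in\partial M$ and $X_e$ is tangent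 to $\partial M$, then $X_g$ is tangent to $\partial M$ for every $g\in\partial M$, and $X$ is complete. (ii) If $e\in\partial M$ and $X_e$ is inward-pointing (resp. outward-pointing), then $J_e=[0,\infty)$ (resp. $J_e=(-\infty,0]$), and $X$ is half-complete. Moreover, in all cases, for every $t\in J_e$ the map $\phi_t$ is defined on all of $M$ and is right translation by $\phi_t(e)$: $J_e\subset J_g$ and $\phi_t(g)=g\,\phi_t(e)$ for all $g\in M$. -/

import Mathlib

open Set
open scoped Manifold ContDiff

noncomputable section

namespace LieMonoid

/-- The model `I` describes smooth manifolds with or without boundary (and without corners): its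
model space is the whole vector space or a closed half-space. -/
def IsBoundaryModel {E H : Type*} [NormedAddCommGroup E] [NormedSpace ℝ E] [TopologicalSpace H]
    (I : ModelWithCorners ℝ E H) : Prop :=
  range I = univ ∨ ∃ l : E →L[ℝ] ℝ, l ≠ 0 ∧ range I = {x | 0 ≤ l x}

/-- The standard model of `n`-dimensional manifolds without boundary. -/
theorem isBoundaryModel_euclidean (n : ℕ) : IsBoundaryModel (𝓡 n) := by
  left
  simp

/-- The standard model of `n`-dimensional manifolds with boundary. -/
theorem isBoundaryModel_euclideanHalfSpace (n : ℕ) [NeZero n] : IsBoundaryModel (𝓡∂ n) := by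
  right
  refine ⟨EuclideanSpace.proj (0 : Fin n), ?_, ?_⟩
  · intro h
    have h1 := congrArg (fun l : EuclideanSpace ℝ (Fin n) →L[ℝ] ℝ =>
      l (EuclideanSpace.single 0 1)) h
    simp at h1
  · exact range_euclideanHalfSpace n

section Boundary

variable {E H M : Type*} [NormedAddCommGroup E] [NormedSpace ℝ E] [TopologicalSpace H]
  (I : ModelWithCorners ℝ E H) [TopologicalSpace M] [ChartedSpace H M]

/-- On the interval `s`, which contains `0`, the map `γ` is a smooth curve in `M` that starts at `p`
with velocity `v` (one-sided if `0` is an endpoint of `s`). -/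
def IsSmoothCurveThrough {p : M} (v : TangentSpace I p) (s : Set ℝ) (γ : ℝ → M) : Prop :=
  ContMDiffOn 𝓘(ℝ, ℝ) I ∞ γ s ∧ γ 0 = p ∧
    HasMFDerivWithinAt 𝓘(ℝ, ℝ) I γ s 0 ((1 : ℝ →L[ℝ] ℝ).smulRight v)

/-- The vector `v` is tangent to `∂M`: it is the velocity of a smooth curve that lies in `∂M`. -/
def IsTangentToBoundary {p : M} (v : TangentSpace I p) : Prop :=
  ∃ ε > 0, ∃ γ : ℝ → M, IsSmoothCurveThrough I v (Ioo (-ε) ε) γ ∧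
    ∀ t ∈ Ioo (-ε) ε, γ t ∈ I.boundary M

/-- The vector `v` at a boundary point is inward-pointing: it is not tangent to `∂M` and it is the
initial velocity of a smooth curve `[0, ε) → M`. -/
def IsInwardPointing {p : M} (v : TangentSpace I p) : Prop :=
  p ∈ I.boundary M ∧ ¬ IsTangentToBoundary I v ∧
    ∃ ε > 0, ∃ γ : ℝ → M, IsSmoothCurveThrough I v (Ico 0 ε) γ

/-- The vector `v` at a boundary point is outward-pointing: it is not tangent to `∂M` and it is the
final velocity of a smooth curve `(-ε, 0] → M`. -/
def IsOutwardPointing {p : M} (v : TangentSpace I p) : Prop :=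
  p ∈ I.boundary M ∧ ¬ IsTangentToBoundary I v ∧
    ∃ ε > 0, ∃ γ : ℝ → M, IsSmoothCurveThrough I v (Ioc (-ε) 0) γ

end Boundary

section IntegralPaths

variable {E H M : Type*} [NormedAddCommGroup E] [NormedSpace ℝ E] [TopologicalSpace H]
  {I : ModelWithCorners ℝ E H} [TopologicalSpace M] [ChartedSpace H M]

/-- `γ`, restricted to `J`, is an integral path of `X` starting at `g`; its domain `J` is an
interval (open or not, possibly degenerate) that contains `0`. -/
structure IsIntegralPathFrom (X : (p : M) → TangentSpace I p) (g : M) (J : Set ℝ) (γ : ℝ → M) :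
    Prop where
  ordConnected : J.OrdConnected
  zero_mem : (0 : ℝ) ∈ J
  start : γ 0 = g
  isIntegralCurve : IsMIntegralCurveOn γ X J

/-- The maximal interval `J_g` on which the integral path of `X` starting at `g` is defined. -/
def maximalInterval (X : (p : M) → TangentSpace I p) (g : M) : Set ℝ :=
  {t | ∃ (J : Set ℝ) (γ : ℝ → M), IsIntegralPathFrom X g J γ ∧ t ∈ J}

open Classical in
/-- The flow `φ_t(g)` of `X`: the value at time `t` of the integral path of `X` starting at `g`.
It is meaningful for `t` in the maximal interval of `g`; elsewhere the value is irrelevant. -/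
def flow (X : (p : M) → TangentSpace I p) (t : ℝ) (g : M) : M :=
  if h : ∃ γ : ℝ → M, ∃ J : Set ℝ, IsIntegralPathFrom X g J γ ∧ t ∈ J then h.choose t else g

/-- `γ` on `J` is the maximal integral path of `X` starting at `g`: every other integral path of
`X` starting at `g` is a restriction of it. -/
def IsMaximalIntegralPathFrom (X : (p : M) → TangentSpace I p) (g : M) (J : Set ℝ) (γ : ℝ → M) :
    Prop :=
  IsIntegralPathFrom X g J γ ∧
    ∀ (J' : Set ℝ) (γ' : ℝ → M), IsIntegralPathFrom X g J' γ' → J' ⊆ J ∧ EqOn γ' γ J'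

/-- All integral paths of `X` are defined for all times. -/
def IsComplete (X : (p : M) → TangentSpace I p) : Prop :=
  ∀ g : M, maximalInterval X g = univ

/-- Every integral path of `X` is defined for all nonnegative or for all nonpositive times. -/
def IsHalfComplete (X : (p : M) → TangentSpace I p) : Prop :=
  ∀ g : M, Ici 0 ⊆ maximalInterval X g ∨ Iic 0 ⊆ maximalInterval X g

end IntegralPaths

section Monoid

variable {E H M : Type*} [NormedAddCommGroup E] [NormedSpace ℝ E] [TopologicalSpace H]
  [TopologicalSpace M] [ChartedSpace H M] [Monoid M]

variable (M) in
/-- A Lie monoid has normal boundary if its unit is an interior point, or `∂M` is a submonoid (so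
that in particular the unit is a boundary point). -/
def HasNormalBoundary (I : ModelWithCorners ℝ E H) : Prop :=
  (1 : M) ∈ I.interior M ∨ ∃ S : Submonoid M, (S : Set M) = I.boundary M

/-- `X` is left-invariant: `d(L_g)_h (X_h) = X_{gh}` for all `g` and `h`. -/
def IsLeftInvariant {I : ModelWithCorners ℝ E H} (X : (p : M) → TangentSpace I p) : Prop :=
  ∀ g h : M, mfderiv I I (fun x : M => g * x) h (X h) = X (g * h)

end Monoid

end LieMonoid

end

/-! Left-invariance makes left translation by `g` carry integral paths to integral paths.
Translating the path from the unit therefore gives a path from `g` on the same interval, so J_e ⊆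
J_g, and uniqueness turns this into φ_t(g) = g φ_t(e). Following a path from the unit up to time s
by its own translate under φ_s(e) shows that nonnegative times in J_e add, so a single positive time
in J_e forces [0, ∞) ⊆ J_e; negative times follow by replacing X with -X.

Everything thus reduces to short-time existence at the unit (`IsLeftInvariant.isComplete`,
`IsLeftInvariant.maximalInterval_one_eq_Ici`). At an interior unit this is the classical theorem. At
a boundary unit, the field in a chart is composed with a Lipschitz retraction onto the boundary
hyperplane or onto the half-space; the composite equation has a solution, and the sign of the normal
component of X shows that it stays where the retraction is the identity. In the tangent case this
needs X tangent along all of ∂M, which holds because ∂M is a submonoid.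

Conversely, the defining functional of the half-space is minimal at boundary points, which restricts
the velocity of any path through them (`nonneg_mul_of_hasMFDerivWithinAt`). This excludes negative
times when X_e points inward, and it derives tangency from completeness when the unit is interior.
-/

namespace LieMonoid

open Filter Metric
open scoped Topology NNReal

/-! ### Gluing integral paths and assembling the maximal one -/

section Global

variable {E H M : Type*} [NormedAddCommGroup E] [NormedSpace ℝ E] [TopologicalSpace H]
  {I : ModelWithCorners ℝ E H} [TopologicalSpace M] [ChartedSpace H M]
  {X : (p : M) → TangentSpace I p}

/-- Two integral curves that agree at a point can be concatenated there. -/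
theorem isMIntegralCurveOn_concat {γ γ' : ℝ → M} {a t b : ℝ} (hat : a ≤ t) (htb : t ≤ b)
    (hγ : IsMIntegralCurveOn γ X (Icc a t)) (hγ' : IsMIntegralCurveOn γ' X (Icc t b))
    (h : γ t = γ' t) :
    IsMIntegralCurveOn (fun s => if s ≤ t then γ s else γ' s) X (Icc a b) := by
  set η : ℝ → M := fun s => if s ≤ t then γ s else γ' s with hη
  have e1 : ∀ s ∈ Icc a t, η s = γ s := fun s hs => if_pos hs.2
  have e2 : ∀ s ∈ Icc t b, η s = γ' s := fun s hs => by
    rcases hs.1.eq_or_lt with h' | h'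
    · rw [← h', hη]; simpa using h
    · exact if_neg h'.not_ge
  have k1 : IsMIntegralCurveOn η X (Icc a t) := fun s hs => by
    have := (hγ s hs).congr_mono e1 (e1 s hs) subset_rfl
    rw [← e1 s hs] at this
    exact this
  have k2 : IsMIntegralCurveOn η X (Icc t b) := fun s hs => by
    have := (hγ' s hs).congr_mono e2 (e2 s hs) subset_rfl
    rw [← e2 s hs] at this
    exact this
  intro s hs
  rcases lt_trichotomy s t with h' | h' | h'
  · refine (k1 s ⟨hs.1, h'.le⟩).mono_of_mem_nhdsWithin ?_
    filter_upwards [self_mem_nhdsWithin, mem_nhdsWithin_of_mem_nhds (Iio_mem_nhds h')] with x hx hx'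
    exact ⟨hx.1, (mem_Iio.1 hx').le⟩
  · subst h'
    rw [← Icc_union_Icc_eq_Icc hat htb]
    exact (k1 s ⟨hat, le_rfl⟩).union (k2 s ⟨le_rfl, htb⟩)
  · refine (k2 s ⟨h'.le, hs.2⟩).mono_of_mem_nhdsWithin ?_
    filter_upwards [self_mem_nhdsWithin, mem_nhdsWithin_of_mem_nhds (Ioi_mem_nhds h')] with x hx hx'
    exact ⟨(mem_Ioi.1 hx').le, hx.2⟩

theorem IsIntegralPathFrom.neg {g : M} {J : Set ℝ} {γ : ℝ → M}
    (h : IsIntegralPathFrom X g J γ) :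
    IsIntegralPathFrom ((-1 : ℝ) • X) g {t | t * (-1) ∈ J} (γ ∘ (· * (-1))) where
  ordConnected := ⟨fun x hx y hy z hz => h.ordConnected.out hy hx
    ⟨by linarith [hz.2], by linarith [hz.1]⟩⟩
  zero_mem := by simpa using h.zero_mem
  start := by simpa using h.start
  isIntegralCurve := h.isIntegralCurve.comp_mul (-1)

theorem neg_neg_field : (-1 : ℝ) • ((-1 : ℝ) • X) = X := by
  rw [smul_smul]; norm_num

theorem neg_mem_maximalInterval {g : M} {t : ℝ} (h : t ∈ maximalInterval X g) :
    -t ∈ maximalInterval ((-1 : ℝ) • X) g := by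
  obtain ⟨J, γ, hγ, ht⟩ := h
  exact ⟨_, _, hγ.neg, by simpa using ht⟩

theorem neg_mem_maximalInterval_iff {g : M} {t : ℝ} :
    -t ∈ maximalInterval ((-1 : ℝ) • X) g ↔ t ∈ maximalInterval X g := by
  refine ⟨fun h => ?_, neg_mem_maximalInterval⟩
  have := neg_mem_maximalInterval h
  rwa [neg_neg_field, neg_neg] at this

theorem ordConnected_maximalInterval (g : M) : (maximalInterval X g).OrdConnected := by
  refine ⟨fun x ⟨J, γ, hγ, hx⟩ y ⟨J', γ', hγ', hy⟩ z hz => ?_⟩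
  rcases le_total 0 z with h | h
  · exact ⟨J', γ', hγ', hγ'.ordConnected.out hγ'.zero_mem hy ⟨h, hz.2⟩⟩
  · exact ⟨J, γ, hγ, hγ.ordConnected.out hx hγ.zero_mem ⟨hz.1, h⟩⟩

/-- At t = 0 the two sides may be covered by different paths, so the flow is differentiated one side
at a time. For t ≥ 0 a path reaching a later time covers the right side; if there is none, the set
is just {t}. -/
theorem exists_path_mem_nhdsWithin_Ici {g : M} {t : ℝ} (ht : t ∈ maximalInterval X g) :
    ∃ J γ, IsIntegralPathFrom X g J γ ∧ t ∈ J ∧ J ∈ 𝓝[maximalInterval X g ∩ Ici t] t := by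
  obtain ⟨J, γ, hγ, htJ⟩ := ht
  rcases lt_or_ge t 0 with h | h
  · refine ⟨J, γ, hγ, htJ, ?_⟩
    filter_upwards [self_mem_nhdsWithin, mem_nhdsWithin_of_mem_nhds (Iio_mem_nhds h)] with x hx hx'
    exact hγ.ordConnected.out htJ hγ.zero_mem ⟨hx.2, (mem_Iio.1 hx').le⟩
  · by_cases hmax : ∃ s ∈ maximalInterval X g, t < s
    · obtain ⟨s, ⟨J', γ', hγ', hs⟩, hts⟩ := hmax
      refine ⟨J', γ', hγ', hγ'.ordConnected.out hγ'.zero_mem hs ⟨h, hts.le⟩, ?_⟩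
      filter_upwards [self_mem_nhdsWithin, mem_nhdsWithin_of_mem_nhds (Iio_mem_nhds hts)]
        with x hx hx'
      exact hγ'.ordConnected.out hγ'.zero_mem hs ⟨h.trans hx.2, (mem_Iio.1 hx').le⟩
    · push Not at hmax
      refine ⟨J, γ, hγ, htJ, ?_⟩
      filter_upwards [self_mem_nhdsWithin] with x hx
      rwa [le_antisymm (hmax x hx.1) hx.2]

theorem exists_path_mem_nhdsWithin_Iic {g : M} {t : ℝ} (ht : t ∈ maximalInterval X g) :
    ∃ J γ, IsIntegralPathFrom X g J γ ∧ t ∈ J ∧ J ∈ 𝓝[maximalInterval X g ∩ Iic t] t := by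
  obtain ⟨J, γ, hγ, htJ, hJ⟩ := exists_path_mem_nhdsWithin_Ici (neg_mem_maximalInterval ht)
  refine ⟨_, _, neg_neg_field (X := X) ▸ hγ.neg, by simpa using htJ, ?_⟩
  have : Tendsto (fun s : ℝ => -s) (𝓝[maximalInterval X g ∩ Iic t] t)
      (𝓝[maximalInterval ((-1 : ℝ) • X) g ∩ Ici (-t)] (-t)) := by
    refine tendsto_nhdsWithin_iff.2 ⟨(continuous_neg.tendsto t).mono_left nhdsWithin_le_nhds, ?_⟩
    filter_upwards [self_mem_nhdsWithin] with x hx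
    exact ⟨neg_mem_maximalInterval hx.1, neg_le_neg (mem_Iic.1 hx.2)⟩
  filter_upwards [this hJ] with x hx
  simpa using hx

/-- If integral paths from `g` are unique, the flow restricts to each of them. -/
theorem flow_eq {g : M}
    (huniq : ∀ J γ J' γ', IsIntegralPathFrom X g J γ → IsIntegralPathFrom X g J' γ' →
      EqOn γ γ' (J ∩ J'))
    {J : Set ℝ} {γ : ℝ → M} (hγ : IsIntegralPathFrom X g J γ) {t : ℝ} (ht : t ∈ J) :
    flow X t g = γ t := by
  have h : ∃ γ : ℝ → M, ∃ J : Set ℝ, IsIntegralPathFrom X g J γ ∧ t ∈ J := ⟨γ, J, hγ, ht⟩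
  rw [flow, dif_pos h]
  obtain ⟨J', hJ', ht'⟩ := h.choose_spec
  exact huniq _ _ _ _ hJ' hγ ⟨ht', ht⟩

theorem isMaximalIntegralPathFrom_flow {g : M}
    (huniq : ∀ J γ J' γ', IsIntegralPathFrom X g J γ → IsIntegralPathFrom X g J' γ' →
      EqOn γ γ' (J ∩ J')) :
    IsMaximalIntegralPathFrom X g (maximalInterval X g) (fun t => flow X t g) := by
  -- The degenerate path puts 0 in the maximal interval; on a singleton any linear map is a
  -- derivative.
  have h0 : IsIntegralPathFrom X g {0} (fun _ => g) := by
    refine ⟨ordConnected_singleton, rfl, rfl, fun t ht => ?_⟩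
    rw [mem_singleton_iff] at ht
    subst ht
    refine ⟨continuousWithinAt_const, ?_⟩
    have hs : ((extChartAt 𝓘(ℝ, ℝ) (0 : ℝ)).symm ⁻¹' {0} ∩ range 𝓘(ℝ, ℝ)) = {(0 : ℝ)} := by
      ext x
      simp [chartAt_self_eq]
    rw [hs]
    exact HasFDerivWithinAt.of_finite (𝕜 := ℝ) (E := ℝ) (F := E) (finite_singleton (0 : ℝ))
  refine ⟨⟨ordConnected_maximalInterval g, ⟨_, _, h0, rfl⟩, flow_eq huniq h0 rfl, ?_⟩,
    fun J γ hγ => ⟨fun t ht => ⟨J, γ, hγ, ht⟩, fun t ht => (flow_eq huniq hγ ht).symm⟩⟩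
  have key : ∀ (t : ℝ) (s : Set ℝ), (∃ J γ, IsIntegralPathFrom X g J γ ∧ t ∈ J ∧ J ∈ 𝓝[s] t) →
      HasMFDerivWithinAt 𝓘(ℝ, ℝ) I (fun t => flow X t g) s t
        ((1 : ℝ →L[ℝ] ℝ).smulRight (X (flow X t g))) := by
    rintro t s ⟨J, γ, hγ, ht, hJ⟩
    have := (hγ.isIntegralCurve t ht).congr_mono (fun s hs => flow_eq huniq hγ hs)
      (flow_eq huniq hγ ht) subset_rfl
    rw [← flow_eq huniq hγ ht] at this
    exact this.mono_of_mem_nhdsWithin hJ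
  intro t ht
  have h1 := key t _ (exists_path_mem_nhdsWithin_Ici ht)
  have h2 := key t _ (exists_path_mem_nhdsWithin_Iic ht)
  have := h2.union h1
  rwa [← inter_union_distrib_left, Iic_union_Ici, inter_univ] at this

end Global

/-! ### Left translation of integral paths and extension in time -/

section Translation

variable {E H M : Type*} [NormedAddCommGroup E] [NormedSpace ℝ E] [TopologicalSpace H]
  {I : ModelWithCorners ℝ E H} [TopologicalSpace M] [ChartedSpace H M] [Monoid M]
  {X : (p : M) → TangentSpace I p}

theorem IsLeftInvariant.neg (hX : IsLeftInvariant X) : IsLeftInvariant ((-1 : ℝ) • X) := by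
  intro g h
  rw [Pi.smul_apply, map_smul, hX g h]
  rfl

variable [ContMDiffMul I ∞ M]

theorem mdifferentiableAt_mul_left (I : ModelWithCorners ℝ E H) [ContMDiffMul I ∞ M] (g h : M) :
    MDifferentiableAt I I (fun x : M => g * x) h :=
  (contMDiff_mul_left (I := I) (n := ∞) (a := g)).mdifferentiable (by simp) h

theorem hasMFDerivWithinAt_mul_left {γ : ℝ → M} {s : Set ℝ} {t : ℝ} {v : TangentSpace I (γ t)}
    (g : M) (h : HasMFDerivWithinAt 𝓘(ℝ, ℝ) I γ s t ((1 : ℝ →L[ℝ] ℝ).smulRight v)) :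
    HasMFDerivWithinAt 𝓘(ℝ, ℝ) I (fun r => g * γ r) s t
      ((1 : ℝ →L[ℝ] ℝ).smulRight (mfderiv I I (fun x : M => g * x) (γ t) v)) := by
  refine ((mdifferentiableAt_mul_left I g (γ t)).hasMFDerivAt.comp_hasMFDerivWithinAt t
    h).congr_mfderiv ?_
  exact ContinuousLinearMap.ext fun a => (mfderiv I I (fun x : M => g * x) (γ t)).map_smul a v

theorem IsLeftInvariant.isIntegralPathFrom_mul (hX : IsLeftInvariant X) {h : M} {J : Set ℝ}
    {γ : ℝ → M} (hγ : IsIntegralPathFrom X h J γ) (g : M) :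
    IsIntegralPathFrom X (g * h) J (fun t => g * γ t) where
  ordConnected := hγ.ordConnected
  zero_mem := hγ.zero_mem
  start := by rw [hγ.start]
  isIntegralCurve := fun t ht => by
    have := hasMFDerivWithinAt_mul_left g (hγ.isIntegralCurve t ht)
    rwa [hX g (γ t)] at this

theorem IsLeftInvariant.maximalInterval_one_subset (hX : IsLeftInvariant X) (g : M) :
    maximalInterval X 1 ⊆ maximalInterval X g := by
  rintro t ⟨J, γ, hγ, ht⟩
  exact ⟨J, _, mul_one g ▸ hX.isIntegralPathFrom_mul hγ g, ht⟩

/-- After time s the path continues as the translate by `γ s` of the path from the unit, shifted in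
time by s. -/
theorem IsLeftInvariant.add_mem_maximalInterval (hX : IsLeftInvariant X) {s t : ℝ} (hs : 0 ≤ s)
    (ht : 0 ≤ t) (hs' : s ∈ maximalInterval X 1) (ht' : t ∈ maximalInterval X 1) :
    s + t ∈ maximalInterval X 1 := by
  obtain ⟨J, γ, hγ, hsJ⟩ := hs'
  obtain ⟨J', γ', hγ', htJ'⟩ := ht'
  have h1 : IsMIntegralCurveOn γ X (Icc 0 s) :=
    hγ.isIntegralCurve.mono (hγ.ordConnected.out hγ.zero_mem hsJ)
  have h2 : IsMIntegralCurveOn ((fun r => γ s * γ' r) ∘ (· + -s)) X (Icc s (s + t)) :=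
    ((hX.isIntegralPathFrom_mul hγ' (γ s)).isIntegralCurve.comp_add (-s)).mono fun r hr =>
      hγ'.ordConnected.out hγ'.zero_mem htJ' ⟨by linarith [hr.1], by linarith [hr.2]⟩
  have h3 := isMIntegralCurveOn_concat hs (by linarith) h1 h2 (by simp [hγ'.start])
  exact ⟨_, _, ⟨ordConnected_Icc, ⟨le_rfl, by linarith⟩, by simp [hs, hγ.start], h3⟩,
    ⟨by linarith, le_rfl⟩⟩

theorem IsLeftInvariant.Ici_subset_maximalInterval (hX : IsLeftInvariant X) {δ : ℝ} (hδ : 0 < δ)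
    (h : δ ∈ maximalInterval X 1) : Ici 0 ⊆ maximalInterval X 1 := by
  have key : ∀ n : ℕ, (n + 1 : ℕ) * δ ∈ maximalInterval X 1 := by
    intro n
    induction n with
    | zero => simpa using h
    | succ n ih =>
      have := hX.add_mem_maximalInterval (by positivity) hδ.le ih h
      convert this using 1
      push_cast
      ring
  intro t ht
  obtain ⟨n, hn⟩ := exists_nat_ge (t / δ)
  rw [div_le_iff₀ hδ] at hn
  obtain ⟨J, γ, hγ, hJ⟩ := key n
  exact ⟨J, γ, hγ, hγ.ordConnected.out hγ.zero_mem hJ ⟨ht, hn.trans (by push_cast; nlinarith)⟩⟩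

theorem IsLeftInvariant.Iic_subset_maximalInterval (hX : IsLeftInvariant X) {δ : ℝ} (hδ : δ < 0)
    (h : δ ∈ maximalInterval X 1) : Iic 0 ⊆ maximalInterval X 1 := fun _ ht =>
  neg_mem_maximalInterval_iff.1 <| hX.neg.Ici_subset_maximalInterval (neg_pos.2 hδ)
    (neg_mem_maximalInterval h) (mem_Ici.2 (neg_nonneg.2 ht))

end Translation

/-! ### Short-time existence in a normed space -/

section ODE

variable {E : Type*} [NormedAddCommGroup E] [NormedSpace ℝ E]

/-- Picard-Lindelöf for an autonomous equation whose right-hand side is Lipschitz near the initial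
point. -/
theorem exists_hasDerivAt_of_lipschitzOnWith [CompleteSpace E] {f : E → E} {x₀ : E} {K : ℝ≥0}
    {s : Set E} (hs : s ∈ 𝓝 x₀) (hl : LipschitzOnWith K f s) :
    ∃ y : ℝ → E, y 0 = x₀ ∧ ∃ ε > 0, ∀ t ∈ Ioo (-ε) ε, HasDerivAt y (f (y t)) t := by
  obtain ⟨a, ha, has⟩ := Metric.nhds_basis_closedBall.mem_iff.1 hs
  have hfb : ∀ x ∈ closedBall x₀ a, ‖f x‖ ≤ ‖f x₀‖ + K * a := fun x hx => by
    have h1 := hl.norm_sub_le (has hx) (mem_of_mem_nhds hs)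
    have h2 : ‖x - x₀‖ ≤ a := by simpa [dist_eq_norm] using hx
    have h3 : (K : ℝ) * ‖x - x₀‖ ≤ K * a := by gcongr
    have h4 := norm_le_norm_sub_add (f x) (f x₀)
    linarith
  -- The summand 1 keeps the speed bound positive, so that the time a / L can be used.
  set L : ℝ := ‖f x₀‖ + K * a + 1
  have hL : 0 < L := by positivity
  set ε : ℝ := a / L
  have hε : 0 < ε := by positivity
  have hp : IsPicardLindelof (fun _ => f) (tmin := -ε) (tmax := ε) ⟨0, by simp [hε.le]⟩ x₀
      ⟨a, ha.le⟩ 0 ⟨L, hL.le⟩ K := by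
    refine IsPicardLindelof.of_time_independent (fun x hx => (hfb x hx).trans ?_) (hl.mono has) ?_
    · change _ ≤ L
      simp [L]
    · change L * max (ε - 0) (0 - -ε) ≤ a - 0
      simp [ε]
      field_simp
      rfl
  obtain ⟨y, hy0, hy⟩ := hp.exists_eq_forall_mem_Icc_hasDerivWithinAt₀
  exact ⟨y, hy0, ε, hε, fun t ht =>
    (hy t (Ioo_subset_Icc_self ht)).hasDerivAt (Icc_mem_nhds ht.1 ht.2)⟩

end ODE

/-! ### Integral curves in charts and uniqueness -/

section Charts

variable {E H M : Type*} [NormedAddCommGroup E] [NormedSpace ℝ E] [TopologicalSpace H]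
  {I : ModelWithCorners ℝ E H} [TopologicalSpace M] [ChartedSpace H M] [IsManifold I ∞ M]
  {X : (p : M) → TangentSpace I p}

/-- The velocity of a curve, read in a chart. -/
theorem hasDerivWithinAt_extChartAt_comp {γ : ℝ → M} {s : Set ℝ} {t : ℝ} {x₀ : M}
    {v : TangentSpace I (γ t)} (hsrc : γ t ∈ (extChartAt I x₀).source)
    (h : HasMFDerivWithinAt 𝓘(ℝ, ℝ) I γ s t ((1 : ℝ →L[ℝ] ℝ).smulRight v)) :
    HasDerivWithinAt (extChartAt I x₀ ∘ γ) (tangentCoordChange I (γ t) x₀ (γ t) v) s t := by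
  have hsrc' := extChartAt_source I x₀ ▸ hsrc
  have h1 := (hasMFDerivAt_extChartAt (I := I) hsrc').comp_hasMFDerivWithinAt t h
  have h2 : HasFDerivWithinAt (extChartAt I x₀ ∘ γ) (_ : ℝ →L[ℝ] E) s t :=
    hasMFDerivWithinAt_iff_hasFDerivWithinAt.1 h1
  refine h2.hasDerivWithinAt.congr_deriv ?_
  rw [← mfderiv_chartAt_eq_tangentCoordChange hsrc']
  exact ((mfderiv I I (chartAt H x₀) (γ t)).map_smul (1 : ℝ) v).trans (one_smul ℝ _)

/-- The velocity of a curve that is given in a chart. -/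
theorem hasMFDerivWithinAt_extChartAt_symm_comp {y : ℝ → E} {s : Set ℝ} {t : ℝ} {x₀ q : M}
    {v : TangentSpace I q} (hs : MapsTo y s (range I)) (hy : y t ∈ (extChartAt I x₀).target)
    (hq : (extChartAt I x₀).symm (y t) = q)
    (h : HasDerivWithinAt y (tangentCoordChange I q x₀ q v) s t) :
    HasMFDerivWithinAt 𝓘(ℝ, ℝ) I ((extChartAt I x₀).symm ∘ y) s t
      ((1 : ℝ →L[ℝ] ℝ).smulRight v) := by
  have hq1 : q ∈ (extChartAt I x₀).source := hq ▸ (extChartAt I x₀).map_target hy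
  have hq2 : q ∈ (extChartAt I q).source := mem_extChartAt_source q
  refine ⟨(continuousAt_extChartAt_symm'' hy).comp_continuousWithinAt h.continuousWithinAt, ?_⟩
  have h1 := hasFDerivWithinAt_tangentCoordChange (I := I) ⟨hq1, hq2⟩
  have hy' : extChartAt I x₀ q = y t := by rw [← hq, (extChartAt I x₀).right_inv hy]
  rw [hy'] at h1
  have h2 := (h1.comp_hasDerivWithinAt t h hs).congr_deriv
    ((tangentCoordChange_comp ⟨⟨hq2, hq1⟩, hq2⟩).trans (tangentCoordChange_self hq2))
  rw [← hq] at h2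
  have hset : (extChartAt 𝓘(ℝ, ℝ) t).symm ⁻¹' s ∩ range 𝓘(ℝ, ℝ) = s := by
    ext x
    simp [chartAt_self_eq]
  rw [hset]
  refine h2.hasFDerivWithinAt.congr_fderiv ?_
  exact ContinuousLinearMap.ext fun a => rfl

variable (X) in
/-- The vector field `X`, read in the chart at `x₀`. -/
noncomputable def chartField (x₀ : M) (y : E) : E :=
  tangentCoordChange I ((extChartAt I x₀).symm y) x₀ ((extChartAt I x₀).symm y)
    (X ((extChartAt I x₀).symm y))

/-- A C¹ map on a convex set is locally Lipschitz relative to it; convexity of `range I` brings in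
boundary points too. -/
theorem exists_lipschitzOnWith_chartField
    (hX : ContMDiff I I.tangent 1 (fun p : M => (⟨p, X p⟩ : TangentBundle I M))) (x₀ : M) :
    ∃ K : ℝ≥0, ∃ t ∈ 𝓝[range I] (extChartAt I x₀ x₀), LipschitzOnWith K (chartField X x₀) t := by
  have h := (contMDiffAt_iff.1 (hX x₀)).2.snd
  exact h.exists_lipschitzOnWith I.convex_range

theorem hasDerivWithinAt_chartField {γ : ℝ → M} {s : Set ℝ} {t : ℝ} {x₀ : M}
    (hγ : IsMIntegralCurveOn γ X s) (ht : t ∈ s) (hsrc : γ t ∈ (extChartAt I x₀).source) :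
    HasDerivWithinAt (extChartAt I x₀ ∘ γ) (chartField X x₀ (extChartAt I x₀ (γ t))) s t := by
  have := hasDerivWithinAt_extChartAt_comp hsrc (hγ t ht)
  rwa [chartField, (extChartAt I x₀).left_inv hsrc]

theorem isMIntegralCurveOn_extChartAt_symm_comp {y : ℝ → E} {s : Set ℝ} {x₀ : M}
    (hs : MapsTo y s (extChartAt I x₀).target)
    (h : ∀ t ∈ s, HasDerivWithinAt y (chartField X x₀ (y t)) s t) :
    IsMIntegralCurveOn ((extChartAt I x₀).symm ∘ y) X s := by
  intro t ht
  exact hasMFDerivWithinAt_extChartAt_symm_comp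
    (hs.mono_right (extChartAt_target_subset_range x₀)) (hs ht) rfl (h t ht)

/-- Integral curves of a `C¹` vector field are unique on intervals, also at boundary points. -/
theorem eqOn_Icc_of_isMIntegralCurveOn [T2Space M]
    (hX : ContMDiff I I.tangent 1 (fun p : M => (⟨p, X p⟩ : TangentBundle I M)))
    {γ γ' : ℝ → M} {a b : ℝ} (hγ : IsMIntegralCurveOn γ X (Icc a b))
    (hγ' : IsMIntegralCurveOn γ' X (Icc a b)) (h : γ a = γ' a) : EqOn γ γ' (Icc a b) := by
  -- Continuous induction: agreement is a closed condition, and the Lipschitz bound in a chart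
  -- propagates it to the right.
  refine IsClosed.Icc_subset_of_forall_exists_gt (s := {t | γ t = γ' t}) ?_ h ?_
  · rw [inter_comm]
    have := (hγ.continuousOn.prodMk hγ'.continuousOn).preimage_isClosed_of_isClosed isClosed_Icc
      isClosed_diagonal
    exact this
  rintro x ⟨hx, hxab⟩ z hz
  rw [mem_ofPred_eq] at hx
  set x₀ := γ x with hx₀
  obtain ⟨K, u, hu, hl⟩ := exists_lipschitzOnWith_chartField hX x₀
  have hxI : x ∈ Icc a b := ⟨hxab.1, hxab.2.le⟩
  have hev : ∀ η : ℝ → M, IsMIntegralCurveOn η X (Icc a b) → η x = x₀ →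
      ∀ᶠ s in 𝓝[Icc a b] x, η s ∈ (extChartAt I x₀).source ∧ extChartAt I x₀ (η s) ∈ u := by
    intro η hη hηx
    have hc := hη.continuousWithinAt hxI
    rw [ContinuousWithinAt, hηx] at hc
    refine (hc.eventually (extChartAt_source_mem_nhds (I := I) x₀)).and ?_
    have : Tendsto (extChartAt I x₀) (𝓝 x₀) (𝓝[range I] (extChartAt I x₀ x₀)) :=
      tendsto_nhdsWithin_iff.2 ⟨continuousAt_extChartAt x₀, Eventually.of_forall fun q =>
        mem_range_self _⟩
    exact (this.comp hc) hu
  have hle : 𝓝[≥] x ≤ 𝓝[Icc a b] x := by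
    rw [← nhdsWithin_Icc_eq_nhdsGE hxab.2]
    exact nhdsWithin_mono _ (Icc_subset_Icc_left hxab.1)
  have hE := ((hev γ hγ rfl).and (hev γ' hγ' hx.symm)).filter_mono hle
  obtain ⟨d, hd, hdE⟩ := (mem_nhdsGE_iff_exists_Icc_subset).1 hE
  rw [mem_Ioi] at hz
  set c := min d (min z b)
  have hxc : x < c := lt_min hd (lt_min hz hxab.2)
  have hcd : c ≤ d := min_le_left _ _
  have hcz : c ≤ z := (min_le_right _ _).trans (min_le_left _ _)
  have hcb : c ≤ b := (min_le_right _ _).trans (min_le_right _ _)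
  have hsub : Icc x c ⊆ Icc a b := Icc_subset_Icc hxab.1 hcb
  have hG : ∀ s ∈ Icc x c, _ := fun s hs => hdE (Icc_subset_Icc_right hcd hs)
  have hder : ∀ η : ℝ → M, IsMIntegralCurveOn η X (Icc a b) →
      (∀ s ∈ Icc x c, η s ∈ (extChartAt I x₀).source) →
      ContinuousOn (extChartAt I x₀ ∘ η) (Icc x c) ∧ ∀ s ∈ Ico x c,
        HasDerivWithinAt (extChartAt I x₀ ∘ η) (chartField X x₀ ((extChartAt I x₀ ∘ η) s))
          (Ici s) s := by
    intro η hη hsrc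
    refine ⟨(continuousOn_extChartAt x₀).comp (hη.continuousOn.mono hsub) hsrc, fun s hs => ?_⟩
    have hs' : s ∈ Icc x c := ⟨hs.1, hs.2.le⟩
    refine ((hasDerivWithinAt_chartField hη (hsub hs') (hsrc s hs')).mono
      (Icc_subset_Icc (hxab.1.trans hs.1) hcb)).mono_of_mem_nhdsWithin ?_
    exact Icc_mem_nhdsGE hs.2
  obtain ⟨c1, d1⟩ := hder γ hγ fun s hs => (hG s hs).1.1
  obtain ⟨c2, d2⟩ := hder γ' hγ' fun s hs => (hG s hs).2.1
  have := ODE_solution_unique_of_mem_Icc_right (v := fun _ => chartField X x₀) (s := fun _ => u)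
    (fun _ _ => hl) c1 d1 (fun s hs => (hG s ⟨hs.1, hs.2.le⟩).1.2) c2 d2
    (fun s hs => (hG s ⟨hs.1, hs.2.le⟩).2.2) (by simp [← hx, ← hx₀])
  have hcc : c ∈ Icc x c := ⟨hxc.le, le_rfl⟩
  exact ⟨c, (extChartAt I x₀).injOn (hG c hcc).1.1 (hG c hcc).2.1 (this hcc), hxc, hcz⟩

theorem contMDiff_neg_field
    (hX : ContMDiff I I.tangent 1 (fun p : M => (⟨p, X p⟩ : TangentBundle I M))) :
    ContMDiff I I.tangent 1 (fun p : M => (⟨p, ((-1 : ℝ) • X) p⟩ : TangentBundle I M)) :=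
  ContMDiff.const_smul_section hX

theorem eqOn_of_isIntegralPathFrom [T2Space M]
    (hX : ContMDiff I I.tangent 1 (fun p : M => (⟨p, X p⟩ : TangentBundle I M)))
    {g : M} {J J' : Set ℝ} {γ γ' : ℝ → M} (hγ : IsIntegralPathFrom X g J γ)
    (hγ' : IsIntegralPathFrom X g J' γ') : EqOn γ γ' (J ∩ J') := by
  have key : ∀ {X : (p : M) → TangentSpace I p}
      (_ : ContMDiff I I.tangent 1 (fun p : M => (⟨p, X p⟩ : TangentBundle I M)))
      {J J' : Set ℝ} {γ γ' : ℝ → M} (_ : IsIntegralPathFrom X g J γ)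
      (_ : IsIntegralPathFrom X g J' γ') (t : ℝ) (_ : t ∈ J) (_ : t ∈ J') (_ : 0 ≤ t),
      γ t = γ' t := fun hX _ _ _ _ hγ hγ' t ht ht' h0 =>
    eqOn_Icc_of_isMIntegralCurveOn hX
      (hγ.isIntegralCurve.mono (hγ.ordConnected.out hγ.zero_mem ht))
      (hγ'.isIntegralCurve.mono (hγ'.ordConnected.out hγ'.zero_mem ht'))
      (hγ.start.trans hγ'.start.symm) ⟨h0, le_rfl⟩
  rintro t ⟨ht, ht'⟩
  rcases le_total 0 t with h | h
  · exact key hX hγ hγ' t ht ht' h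
  · simpa using key (contMDiff_neg_field hX) hγ.neg hγ'.neg (-t) (by simpa using ht)
      (by simpa using ht') (neg_nonneg.2 h)

end Charts

/-! ### Tangency and existence at boundary points -/

section HalfSpace

variable {E H M : Type*} [NormedAddCommGroup E] [NormedSpace ℝ E] [TopologicalSpace H]
  {I : ModelWithCorners ℝ E H} [TopologicalSpace M] [ChartedSpace H M] [IsManifold I ∞ M]
  {X : (p : M) → TangentSpace I p} {l : E →L[ℝ] ℝ}

theorem exists_apply_eq_one (hl : l ≠ 0) : ∃ w, l w = 1 := by
  obtain ⟨x, hx⟩ : ∃ x, l x ≠ 0 := by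
    by_contra! h
    exact hl (ContinuousLinearMap.ext h)
  exact ⟨(l x)⁻¹ • x, by simp [hx]⟩

theorem interior_halfSpace (hl : l ≠ 0) : interior {x | 0 ≤ l x} = {x | 0 < l x} := by
  have ho : IsOpenMap l := l.isOpenMap_of_ne_zero hl
  have := ho.preimage_interior_eq_interior_preimage l.continuous (Ici 0)
  rw [interior_Ici] at this
  exact this.symm

/-- In any chart, the boundary points are those at which the defining functional vanishes. -/
theorem mem_boundary_iff (hl : l ≠ 0) (hI : range I = {x | 0 ≤ l x}) {x₀ q : M}
    (hq : q ∈ (extChartAt I x₀).source) :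
    q ∈ I.boundary M ↔ l (extChartAt I x₀ q) = 0 := by
  have hq' : q ∈ (chartAt H x₀).source := extChartAt_source I x₀ ▸ hq
  have hr : 0 ≤ l (extChartAt I x₀ q) := by
    have : extChartAt I x₀ q ∈ range I := mem_range_self _
    rwa [hI] at this
  change I.IsBoundaryPoint q ↔ _
  rw [I.isBoundaryPoint_iff_not_isInteriorPoint,
    I.isInteriorPoint_iff_of_mem_atlas (n := ∞) (by simp) (chart_mem_atlas H x₀) hq']
  have : extChartAt I x₀ q ∈ interior (extChartAt I x₀).target ↔ 0 < l (extChartAt I x₀ q) := by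
    have hi : ∀ x, x ∈ interior (range I) ↔ 0 < l x := fun x => by
      rw [hI, interior_halfSpace hl]; rfl
    rw [← hi]
    exact ⟨fun h => interior_mono (extChartAt_target_subset_range x₀) h,
      fun h => (chartAt H x₀).mem_interior_extend_target
        ((chartAt H x₀).map_source hq') h⟩
  change ¬ extChartAt I x₀ q ∈ interior (extChartAt I x₀).target ↔ _
  rw [this, not_lt]
  exact ⟨fun h => le_antisymm h hr, le_of_eq⟩

/-- The velocity at a boundary point of a curve in `M` that is defined from time `0` to time `a`
does not point out of `M`. -/
theorem nonneg_mul_of_hasMFDerivWithinAt (hl : l ≠ 0) (hI : range I = {x | 0 ≤ l x}) {x₀ p : M}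
    (hp : p ∈ I.boundary M) (hsrc : p ∈ (extChartAt I x₀).source) {v : TangentSpace I p}
    {γ : ℝ → M} {s : Set ℝ} {a : ℝ} (h0 : γ 0 = p)
    (h : HasMFDerivWithinAt 𝓘(ℝ, ℝ) I γ s 0 ((1 : ℝ →L[ℝ] ℝ).smulRight v))
    (ha : segment ℝ 0 a ⊆ s) : 0 ≤ a * l (tangentCoordChange I p x₀ p v) := by
  subst h0
  have h1 := hasDerivWithinAt_extChartAt_comp hsrc h
  have h2 := (l.hasFDerivAt.comp_hasDerivWithinAt (0 : ℝ) h1).hasFDerivWithinAt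
  -- The functional vanishes at `p` and is nonnegative on all of M.
  have hmin : IsLocalMinOn (l ∘ extChartAt I x₀ ∘ γ) s 0 := by
    refine Eventually.of_forall fun t => ?_
    simp only [Function.comp_apply]
    rw [(mem_boundary_iff hl hI hsrc).1 hp]
    have : extChartAt I x₀ (γ t) ∈ range I := mem_range_self _
    rwa [hI] at this
  have := hmin.hasFDerivWithinAt_nonneg h2 (y := a)
    (mem_posTangentConeAt_of_segment_subset (by simpa using ha))
  simpa using this

theorem apply_eq_zero_of_hasMFDerivWithinAt (hl : l ≠ 0) (hI : range I = {x | 0 ≤ l x}) {x₀ p : M}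
    (hp : p ∈ I.boundary M) (hsrc : p ∈ (extChartAt I x₀).source) {v : TangentSpace I p}
    {γ : ℝ → M} {s : Set ℝ} {ε : ℝ} (hε : 0 < ε) (hs : Ioo (-ε) ε ⊆ s) (h0 : γ 0 = p)
    (h : HasMFDerivWithinAt 𝓘(ℝ, ℝ) I γ s 0 ((1 : ℝ →L[ℝ] ℝ).smulRight v)) :
    l (tangentCoordChange I p x₀ p v) = 0 := by
  have key : ∀ a ∈ Ioo (-ε) ε, 0 ≤ a * l (tangentCoordChange I p x₀ p v) := fun a ha =>
    nonneg_mul_of_hasMFDerivWithinAt hl hI hp hsrc h0 h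
      (((convex_Ioo _ _).segment_subset ⟨by linarith, hε⟩ ha).trans hs)
  have h1 := key (ε / 2) ⟨by linarith, by linarith⟩
  have h2 := key (-(ε / 2)) ⟨by linarith, by linarith⟩
  nlinarith

theorem isTangentToBoundary_of_apply_eq_zero (hl : l ≠ 0) (hI : range I = {x | 0 ≤ l x}) {p : M}
    (hp : p ∈ I.boundary M) {v : TangentSpace I p} (hv : l (tangentCoordChange I p p p v) = 0) :
    IsTangentToBoundary I v := by
  have hps := mem_extChartAt_source (I := I) p
  have hp0 : l (extChartAt I p p) = 0 := (mem_boundary_iff hl hI hps).1 hp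
  -- The witness is a straight line in the chart; it lies in the hyperplane l = 0.
  set y : ℝ → E := fun t => extChartAt I p p + t • tangentCoordChange I p p p v with hy
  have hyl : ∀ t, l (y t) = 0 := fun t => by simp only [hy, map_add, map_smul, hp0, hv, smul_zero, add_zero]
  have hyr : ∀ t, y t ∈ range I := fun t => by rw [hI]; exact (hyl t).ge
  have hyc : ContDiff ℝ ∞ y := by fun_prop
  have hy0 : y 0 = extChartAt I p p := by simp only [hy, zero_smul, add_zero]
  have ht : ∀ᶠ t in 𝓝 (0 : ℝ), y t ∈ (extChartAt I p).target := by
    have : Tendsto y (𝓝 0) (𝓝[range I] (extChartAt I p p)) :=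
      tendsto_nhdsWithin_iff.2 ⟨hy0 ▸ hyc.continuous.tendsto 0, Eventually.of_forall hyr⟩
    exact this (extChartAt_target_mem_nhdsWithin p)
  obtain ⟨ε, hε, hεt⟩ := Metric.eventually_nhds_iff_ball.1 ht
  rw [Real.ball_eq_Ioo, zero_sub, zero_add] at hεt
  have hq : (extChartAt I p).symm (y 0) = p := by rw [hy0, extChartAt_to_inv]
  refine ⟨ε, hε, (extChartAt I p).symm ∘ y, ⟨?_, hq, ?_⟩, fun t ht => ?_⟩
  · exact (contMDiffOn_extChartAt_symm p).comp hyc.contMDiff.contMDiffOn hεt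
  · refine hasMFDerivWithinAt_extChartAt_symm_comp (fun t _ => hyr t)
      (hεt 0 ⟨by linarith, hε⟩) hq ?_
    have := ((hasDerivAt_id (0 : ℝ)).smul_const (tangentCoordChange I p p p v)).const_add
      (extChartAt I p p)
    rw [one_smul] at this
    exact this.hasDerivWithinAt
  · have h1 := (extChartAt I p).map_target (hεt t ht)
    refine (mem_boundary_iff hl hI h1).2 ?_
    exact ((extChartAt I p).right_inv (hεt t ht)).symm ▸ hyl t

theorem continuousWithinAt_chartField
    (hX : ContMDiff I I.tangent 1 (fun p : M => (⟨p, X p⟩ : TangentBundle I M))) (p : M) :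
    ContinuousWithinAt (chartField X p) (range I) (extChartAt I p p) := by
  obtain ⟨K, t, ht, hK⟩ := exists_lipschitzOnWith_chartField hX p
  exact (hK.continuousOn _ (mem_of_mem_nhdsWithin (mem_range_self (f := I) _) ht)).mono_of_mem_nhdsWithin ht

/-- Solutions of the differential equation of a vector field, extended from a chart to the whole
model space by a Lipschitz retraction. -/
theorem exists_hasDerivAt_chartField_comp [CompleteSpace E]
    (hX : ContMDiff I I.tangent 1 (fun p : M => (⟨p, X p⟩ : TangentBundle I M))) {p : M}
    {r : E → E} {K : ℝ≥0} (hr : LipschitzWith K r) (hrI : ∀ x, r x ∈ range I)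
    (hrp : r (extChartAt I p p) = extChartAt I p p) {u : Set E}
    (hu : u ∈ 𝓝[range I] (extChartAt I p p)) :
    ∃ y : ℝ → E, y 0 = extChartAt I p p ∧ ∃ ε > 0, ∀ t ∈ Ioo (-ε) ε,
      HasDerivAt y (chartField X p (r (y t))) t ∧ r (y t) ∈ u := by
  obtain ⟨K', s, hs, hl⟩ := exists_lipschitzOnWith_chartField hX p
  have hrt : Tendsto r (𝓝 (extChartAt I p p)) (𝓝[range I] (extChartAt I p p)) := by
    refine tendsto_nhdsWithin_iff.2 ⟨?_, Eventually.of_forall hrI⟩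
    have := hr.continuous.tendsto (extChartAt I p p)
    rwa [hrp] at this
  obtain ⟨y, hy0, ε, hε, hy⟩ := exists_hasDerivAt_of_lipschitzOnWith (hrt hs)
    (hl.comp (hr.lipschitzOnWith (s := r ⁻¹' s)) (mapsTo_preimage r s))
  have hyc : Tendsto y (𝓝 0) (𝓝 (extChartAt I p p)) :=
    hy0 ▸ (hy 0 ⟨by linarith, hε⟩).continuousAt
  obtain ⟨δ, hδ, hδu⟩ := Metric.eventually_nhds_iff_ball.1 ((hrt.comp hyc).eventually hu)
  rw [Real.ball_eq_Ioo, zero_sub, zero_add] at hδu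
  have h1 := min_le_left ε δ
  have h2 := min_le_right ε δ
  exact ⟨y, hy0, min ε δ, lt_min hε hδ, fun t ht =>
    ⟨hy t ⟨by linarith [ht.1], by linarith [ht.2]⟩, hδu t ⟨by linarith [ht.1], by linarith [ht.2]⟩⟩⟩

/-- A vector field that is tangent to the boundary has integral paths, in both directions of time,
from boundary points. -/
theorem exists_isIntegralPathFrom_of_tangent [CompleteSpace E] (hl : l ≠ 0)
    (hI : range I = {x | 0 ≤ l x})
    (hX : ContMDiff I I.tangent 1 (fun p : M => (⟨p, X p⟩ : TangentBundle I M)))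
    (ht : ∀ q ∈ I.boundary M, IsTangentToBoundary I (X q)) {p : M} (hp : p ∈ I.boundary M) :
    ∃ ε > 0, ∃ γ, IsIntegralPathFrom X p (Ioo (-ε) ε) γ := by
  obtain ⟨w, hw⟩ := exists_apply_eq_one hl
  have hps := mem_extChartAt_source (I := I) p
  have hp0 : l (extChartAt I p p) = 0 := (mem_boundary_iff hl hI hps).1 hp
  -- Linear projection along `w` onto the hyperplane l = 0.
  set r : E → E := fun x => x - l x • w with hr
  have hrl : ∀ x, l (r x) = 0 := fun x => by simp [hr, hw]
  have hrL : LipschitzWith _ r := LipschitzWith.id.sub (l.smulRight w).lipschitz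
  obtain ⟨y, hy0, ε, hε, hy⟩ := exists_hasDerivAt_chartField_comp hX hrL
    (fun x => by rw [hI]; exact (hrl x).ge) (by simp only [hr, hp0, zero_smul, sub_zero])
    (extChartAt_target_mem_nhdsWithin p)
  have h0 : (0 : ℝ) ∈ Ioo (-ε) ε := ⟨by linarith, hε⟩
  have hf : ∀ x ∈ (extChartAt I p).target, l x = 0 → l (chartField X p x) = 0 := by
    intro x hx hlx
    have hq := (extChartAt I p).map_target hx
    have hqb : (extChartAt I p).symm x ∈ I.boundary M :=
      (mem_boundary_iff hl hI hq).2 (by rw [(extChartAt I p).right_inv hx, hlx])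
    obtain ⟨δ, hδ, c, hc, -⟩ := ht _ hqb
    exact apply_eq_zero_of_hasMFDerivWithinAt hl hI hqb hq hδ subset_rfl hc.2.1 hc.2.2
  -- The field is evaluated at `r (y t)`, a boundary point, where it is tangent; so l is constant
  -- along `y`.
  have hyl : ∀ t ∈ Ioo (-ε) ε, l (y t) = 0 := by
    have hd : ∀ t ∈ Ioo (-ε) ε, HasDerivAt (l ∘ y) 0 t := fun t ht => by
      have := l.hasFDerivAt.comp_hasDerivAt t (hy t ht).1
      rwa [hf _ (hy t ht).2 (hrl _)] at this
    intro t ht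
    have := isOpen_Ioo.is_const_of_deriv_eq_zero isPreconnected_Ioo
      (fun t ht => (hd t ht).differentiableAt.differentiableWithinAt)
      (fun t ht => (hd t ht).deriv) ht h0
    rwa [Function.comp_apply, Function.comp_apply, hy0, hp0] at this
  have hry : ∀ t ∈ Ioo (-ε) ε, r (y t) = y t := fun t ht => by simp [hr, hyl t ht]
  refine ⟨ε, hε, (extChartAt I p).symm ∘ y, ordConnected_Ioo, h0, by simp [hy0], ?_⟩
  exact isMIntegralCurveOn_extChartAt_symm_comp (fun t ht => hry t ht ▸ (hy t ht).2)
    fun t ht => by simpa only [hry t ht] using (hy t ht).1.hasDerivWithinAt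

/-- A vector field has an integral path in positive time from a boundary point at which it points
into the manifold. -/
theorem exists_isIntegralPathFrom_of_pos [CompleteSpace E] (hl : l ≠ 0)
    (hI : range I = {x | 0 ≤ l x})
    (hX : ContMDiff I I.tangent 1 (fun p : M => (⟨p, X p⟩ : TangentBundle I M)))
    {p : M} (hp : p ∈ I.boundary M) (hXp : 0 < l (tangentCoordChange I p p p (X p))) :
    ∃ ε > 0, ∃ γ, IsIntegralPathFrom X p (Ico 0 ε) γ := by
  obtain ⟨w, hw⟩ := exists_apply_eq_one hl
  have hps := mem_extChartAt_source (I := I) p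
  have hp0 : l (extChartAt I p p) = 0 := (mem_boundary_iff hl hI (mem_extChartAt_source p)).1 hp
  -- Retraction onto the half-space, moving only points with l < 0.
  set r : E → E := fun x => x - (min (l x) 0) • w with hr
  have hrL : LipschitzWith _ r := LipschitzWith.id.sub
    ((ContinuousLinearMap.toSpanSingleton ℝ w).lipschitz.comp (l.lipschitz.min_const 0))
  have hrl : ∀ x, 0 ≤ l (r x) := fun x => by simp [hr, hw]
  have hfpos : ∀ᶠ x in 𝓝[range I] (extChartAt I p p), 0 < l (chartField X p x) := by
    refine (l.continuous.continuousAt.comp_continuousWithinAt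
      (continuousWithinAt_chartField hX p)).eventually (lt_mem_nhds ?_)
    rw [Function.comp_apply, chartField, extChartAt_to_inv]
    exact hXp
  obtain ⟨y, hy0, ε, hε, hy⟩ := exists_hasDerivAt_chartField_comp hX hrL
    (fun x => by rw [hI]; exact hrl x) (by simp only [hr, hp0, min_self, zero_smul, sub_zero])
    (inter_mem (extChartAt_target_mem_nhdsWithin p) hfpos)
  have hsub : Ico 0 ε ⊆ Ioo (-ε) ε := fun t ht => ⟨by linarith [ht.1], ht.2⟩
  have hd : ∀ t ∈ Ioo (-ε) ε, HasDerivAt (l ∘ y) (l (chartField X p (r (y t)))) t := fun t ht =>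
    l.hasFDerivAt.comp_hasDerivAt t (hy t ht).1
  -- Near `p` the normal component of the field is positive, so l increases from 0 along `y` and the
  -- retraction is inactive for t ≥ 0.
  have hmono : MonotoneOn (l ∘ y) (Ioo (-ε) ε) := by
    refine monotoneOn_of_deriv_nonneg (convex_Ioo _ _)
      (fun t ht => (hd t ht).continuousAt.continuousWithinAt)
      (fun t ht => (hd t (interior_subset ht)).differentiableAt.differentiableWithinAt)
      fun t ht => ?_
    rw [(hd t (interior_subset ht)).deriv]
    exact le_of_lt (hy t (interior_subset ht)).2.2
  have hry : ∀ t ∈ Ico 0 ε, r (y t) = y t := fun t ht => by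
    have := hmono (hsub ⟨le_rfl, hε⟩) (hsub ht) ht.1
    rw [Function.comp_apply, Function.comp_apply, hy0, hp0] at this
    simp [hr, this]
  refine ⟨ε, hε, (extChartAt I p).symm ∘ y, ordConnected_Ico, ⟨le_rfl, hε⟩, by simp [hy0], ?_⟩
  exact isMIntegralCurveOn_extChartAt_symm_comp (fun t ht => hry t ht ▸ (hy t (hsub ht)).2.1)
    fun t ht => by simpa only [hry t ht] using (hy t (hsub ht)).1.hasDerivWithinAt

/-- The one-sided curve gives the weak inequality; non-tangency excludes zero. -/
theorem IsInwardPointing.apply_pos (hl : l ≠ 0)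
    (hI : range I = {x | 0 ≤ l x}) {p : M} {v : TangentSpace I p} (h : IsInwardPointing I v) :
    0 < l (tangentCoordChange I p p p v) := by
  obtain ⟨hp, hnt, ε, hε, γ, -, h0, hd⟩ := h
  have hne : l (tangentCoordChange I p p p v) ≠ 0 := fun h =>
    hnt (isTangentToBoundary_of_apply_eq_zero hl hI hp h)
  have := nonneg_mul_of_hasMFDerivWithinAt hl hI hp (mem_extChartAt_source p) h0 hd (a := ε / 2)
    ((convex_Ico _ _).segment_subset ⟨le_rfl, hε⟩ ⟨by linarith, by linarith⟩)
  exact lt_of_le_of_ne (nonneg_of_mul_nonneg_right this (by linarith)) hne.symm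

theorem IsOutwardPointing.apply_neg (hl : l ≠ 0)
    (hI : range I = {x | 0 ≤ l x}) {p : M} {v : TangentSpace I p} (h : IsOutwardPointing I v) :
    l (tangentCoordChange I p p p v) < 0 := by
  obtain ⟨hp, hnt, ε, hε, γ, -, h0, hd⟩ := h
  have hne : l (tangentCoordChange I p p p v) ≠ 0 := fun h =>
    hnt (isTangentToBoundary_of_apply_eq_zero hl hI hp h)
  have := nonneg_mul_of_hasMFDerivWithinAt hl hI hp (mem_extChartAt_source p) h0 hd (a := -(ε / 2))
    ((convex_Ioc _ _).segment_subset ⟨by linarith, le_rfl⟩ ⟨by linarith, by linarith⟩)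
  refine lt_of_le_of_ne ?_ hne
  nlinarith

end HalfSpace

/-! ### Consequences at the unit -/

section Main

variable {E H M : Type*} [NormedAddCommGroup E] [NormedSpace ℝ E] [TopologicalSpace H]
  {I : ModelWithCorners ℝ E H} [TopologicalSpace M] [ChartedSpace H M]

theorem IsBoundaryModel.exists_of_mem_boundary (hI : IsBoundaryModel I) {p : M}
    (hp : p ∈ I.boundary M) : ∃ l : E →L[ℝ] ℝ, l ≠ 0 ∧ range I = {x | 0 ≤ l x} := by
  refine hI.resolve_left fun h => ?_
  have : extChartAt I p p ∈ frontier (range I) := hp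
  rw [h, frontier_univ] at this
  exact this

variable [Monoid M] [ContMDiffMul I ∞ M] {X : (p : M) → TangentSpace I p}

theorem IsTangentToBoundary.mul_left {v : TangentSpace I (1 : M)} (h : IsTangentToBoundary I v)
    {S : Submonoid M} (hS : (S : Set M) = I.boundary M) {g : M} (hg : g ∈ I.boundary M) :
    IsTangentToBoundary I (p := g * 1) (mfderiv I I (fun x : M => g * x) 1 v) := by
  obtain ⟨ε, hε, γ, ⟨hγ, h0, hd⟩, hb⟩ := h
  refine ⟨ε, hε, fun t => g * γ t, ⟨?_, congrArg (g * ·) h0, ?_⟩, fun t ht => ?_⟩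
  · exact (contMDiff_mul_left (I := I) (n := ∞) (a := g)).comp_contMDiffOn hγ
  · have := hasMFDerivWithinAt_mul_left g hd
    rw [h0] at this
    exact this
  · have hγt := hb t ht
    rw [← hS] at hg hγt ⊢
    exact S.mul_mem hg hγt

theorem IsLeftInvariant.isTangentToBoundary (hX : IsLeftInvariant X) {S : Submonoid M}
    (hS : (S : Set M) = I.boundary M) (h : IsTangentToBoundary I (X 1)) {g : M}
    (hg : g ∈ I.boundary M) : IsTangentToBoundary I (X g) := by
  have := h.mul_left hS hg
  rwa [hX g 1, mul_one] at this

theorem IsLeftInvariant.isComplete (hX : IsLeftInvariant X) {ε : ℝ} (hε : 0 < ε) {γ : ℝ → M}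
    (h : IsIntegralPathFrom X 1 (Ioo (-ε) ε) γ) : IsComplete X := by
  intro g
  refine univ_subset_iff.1 fun t _ => hX.maximalInterval_one_subset g ?_
  rcases le_total 0 t with ht | ht
  · exact hX.Ici_subset_maximalInterval (δ := ε / 2) (by linarith)
      ⟨_, _, h, by linarith, by linarith⟩ ht
  · exact hX.Iic_subset_maximalInterval (δ := -(ε / 2)) (by linarith)
      ⟨_, _, h, by linarith, by linarith⟩ ht

theorem IsLeftInvariant.maximalInterval_one_eq_Ici [CompleteSpace E] (hX : IsLeftInvariant X)
    (hXs : ContMDiff I I.tangent 1 (fun p : M => (⟨p, X p⟩ : TangentBundle I M)))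
    {l : E →L[ℝ] ℝ} (hl : l ≠ 0) (hI : range I = {x | 0 ≤ l x}) (h1 : (1 : M) ∈ I.boundary M)
    (hpos : 0 < l (tangentCoordChange I (1 : M) 1 1 (X 1))) :
    maximalInterval X 1 = Ici 0 := by
  refine Subset.antisymm ?_ ?_
  · rintro t ⟨J, γ, hγ, ht⟩
    by_contra hneg
    rw [mem_Ici, not_le] at hneg
    have hd := hγ.isIntegralCurve 0 hγ.zero_mem
    rw [hγ.start] at hd
    have := nonneg_mul_of_hasMFDerivWithinAt hl hI h1 (mem_extChartAt_source 1) hγ.start hd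
      (a := t) (hγ.ordConnected.convex.segment_subset hγ.zero_mem ht)
    nlinarith
  · obtain ⟨ε, hε, γ, hγ⟩ := exists_isIntegralPathFrom_of_pos hl hI hXs h1 hpos
    exact hX.Ici_subset_maximalInterval (δ := ε / 2) (by linarith)
      ⟨_, _, hγ, by linarith, by linarith⟩

end Main

end LieMonoid

theorem mainTheorem12 {E H M : Type*}
    [NormedAddCommGroup E] [NormedSpace ℝ E] [FiniteDimensional ℝ E]
    [TopologicalSpace H] (I : ModelWithCorners ℝ E H) (hI : LieMonoid.IsBoundaryModel I)
    [TopologicalSpace M] [T2Space M] [ChartedSpace H M] [Monoid M] [ContMDiffMul I ∞ M]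
    (hM : LieMonoid.HasNormalBoundary M I)
    (X : (p : M) → TangentSpace I p)
    (hXsmooth : ContMDiff I I.tangent ∞ (fun p : M => (⟨p, X p⟩ : TangentBundle I M)))
    (hX : LieMonoid.IsLeftInvariant X) :
    -- every point has a maximal integral path, with domain `J_g` and values `φ_t(g)`
    (∀ g : M, LieMonoid.IsMaximalIntegralPathFrom X g (LieMonoid.maximalInterval X g)
      (fun t => LieMonoid.flow X t g)) ∧
    -- interior unit, or boundary unit and `X_e` tangent to the boundary
    (((1 : M) ∈ I.interior M ∨
        ((1 : M) ∈ I.boundary M ∧ LieMonoid.IsTangentToBoundary I (X 1))) →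
      (∀ g ∈ I.boundary M, LieMonoid.IsTangentToBoundary I (X g)) ∧ LieMonoid.IsComplete X) ∧
    -- boundary unit and `X_e` inward-pointing
    (((1 : M) ∈ I.boundary M ∧ LieMonoid.IsInwardPointing I (X 1)) →
      LieMonoid.maximalInterval X 1 = Ici 0 ∧ LieMonoid.IsHalfComplete X) ∧
    -- boundary unit and `X_e` outward-pointing
    (((1 : M) ∈ I.boundary M ∧ LieMonoid.IsOutwardPointing I (X 1)) →
      LieMonoid.maximalInterval X 1 = Iic 0 ∧ LieMonoid.IsHalfComplete X) ∧
    -- for `t ∈ J_e` the flow is defined on all of `M` and is right translation by `φ_t(e)`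
    (∀ t ∈ LieMonoid.maximalInterval X 1, ∀ g : M,
      t ∈ LieMonoid.maximalInterval X g ∧
        LieMonoid.flow X t g = g * LieMonoid.flow X t 1) := by
  have hXs : ContMDiff I I.tangent 1 (fun p : M => (⟨p, X p⟩ : TangentBundle I M)) :=
    hXsmooth.of_le (by simp)
  have hcomplete : CompleteSpace E := FiniteDimensional.complete ℝ E
  have huniq : ∀ (g : M) J γ J' γ', LieMonoid.IsIntegralPathFrom X g J γ →
      LieMonoid.IsIntegralPathFrom X g J' γ' → EqOn γ γ' (J ∩ J') := fun g _ _ _ _ h h' =>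
    LieMonoid.eqOn_of_isIntegralPathFrom hXs h h'
  have hmax := fun g => LieMonoid.isMaximalIntegralPathFrom_flow (huniq g)
  refine ⟨hmax, ?_, ?_, ?_, fun t ht g => ⟨hX.maximalInterval_one_subset g ht, ?_⟩⟩
  · rintro (h1 | ⟨h1, htan⟩)
    · obtain ⟨γ, h0, hγ⟩ := exists_isMIntegralCurveAt_of_contMDiffAt 0 (hXs 1) h1
      obtain ⟨ε, hε, hγ⟩ := isMIntegralCurveAt_iff'.1 hγ
      rw [Real.ball_eq_Ioo, zero_sub, zero_add] at hγ
      have hc : LieMonoid.IsComplete X :=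
        hX.isComplete hε ⟨ordConnected_Ioo, ⟨by linarith, hε⟩, h0, hγ⟩
      -- Completeness gives a two-sided path through each boundary point, which forces its velocity
      -- to be tangent.
      refine ⟨fun g hg => ?_, hc⟩
      obtain ⟨l, hl, hlI⟩ := hI.exists_of_mem_boundary hg
      have hp := (hmax g).1
      rw [hc g] at hp
      have hd := hp.isIntegralCurve 0 (mem_univ 0)
      rw [hp.start] at hd
      exact LieMonoid.isTangentToBoundary_of_apply_eq_zero hl hlI hg
        (LieMonoid.apply_eq_zero_of_hasMFDerivWithinAt hl hlI hg (mem_extChartAt_source g)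
          one_pos (subset_univ _) hp.start hd)
    · obtain ⟨l, hl, hlI⟩ := hI.exists_of_mem_boundary h1
      obtain ⟨S, hS⟩ := hM.resolve_left fun h =>
        (ModelWithCorners.disjoint_interior_boundary (I := I)).le_bot ⟨h, h1⟩
      have ht : ∀ g ∈ I.boundary M, LieMonoid.IsTangentToBoundary I (X g) := fun g hg =>
        hX.isTangentToBoundary hS htan hg
      obtain ⟨ε, hε, γ, hγ⟩ := LieMonoid.exists_isIntegralPathFrom_of_tangent hl hlI hXs ht h1
      exact ⟨ht, hX.isComplete hε hγ⟩
  · rintro ⟨h1, hin⟩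
    obtain ⟨l, hl, hlI⟩ := hI.exists_of_mem_boundary h1
    have he := hX.maximalInterval_one_eq_Ici hXs hl hlI h1 (hin.apply_pos hl hlI)
    exact ⟨he, fun g => Or.inl (he ▸ hX.maximalInterval_one_subset g)⟩
  · rintro ⟨h1, hout⟩
    obtain ⟨l, hl, hlI⟩ := hI.exists_of_mem_boundary h1
    -- Time reversal: -X has positive normal component at the unit.
    have hneg := hX.neg.maximalInterval_one_eq_Ici (LieMonoid.contMDiff_neg_field hXs) hl hlI h1 <| by
      have h2 := hout.apply_neg hl hlI
      have h3 : tangentCoordChange I (1 : M) 1 1 (((-1 : ℝ) • X) 1) =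
          (-1 : ℝ) • tangentCoordChange I (1 : M) 1 1 (X 1) :=
        (tangentCoordChange I (1 : M) 1 1).map_smul (-1 : ℝ) (X 1)
      rw [h3, map_smul, smul_eq_mul]
      linarith
    have he : LieMonoid.maximalInterval X 1 = Iic 0 := by
      ext t
      rw [← LieMonoid.neg_mem_maximalInterval_iff, hneg, mem_Ici, mem_Iic, neg_nonneg]
    exact ⟨he, fun g => Or.inr (he ▸ hX.maximalInterval_one_subset g)⟩
  · have := hX.isIntegralPathFrom_mul (hmax 1).1 g
    rw [mul_one] at this
    exact LieMonoid.flow_eq (huniq g) this ht
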